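/- Let $\mathsf T$ be a Krull–Schmidt triangulated category with suspension functor $\Sigma$; all subcategories are full and closed under isomorphisms. A subcategory $\mathsf S$ of $\mathsf T$ is *partial silting* if $\mathrm{Hom}_{\mathsf T}(x,\Sigma^i y)=0$ for all $x,y\in\mathsf S$ and all $i>0$; it is *silting* if moreover the smallest thick subcategory of $\mathsf T$ containing $\mathsf S$ is $\mathsf T$. A partial silting subcategory $\mathsf S$ is *almost silting* if there is an indecomposable object $s$ of $\mathsf T$ such that $\mathrm{add}(\mathsf S\cup\{s\})$ is silting; such an $s$ is called a *complement* of $\mathsf S$. A *co-t-structure* in $\mathsf T$ is a pair $(\mathsf A,\mathsf B)$ of subcategories closed under finite direct sums and direct summands such that $\Sigma^{-1}\mathsf A\subseteq\mathsf A$, $\Sigma\mathsf B\subseteq\mathsf B$, $\mathrm{Hom}_{\mathsf T}(a,b)=0$ for all $a\in\mathsf A$, $b\in\mathsf B$, and every object $t$ of $\mathsf T$ sits in a distinguished triangle $a\to t\to b\to\Sigma a$ with $a\in\mathsf A$, $b\in\mathsf B$. Its *co-heart* is $\mathsf C=\mathsf A\cap\Sigma^{-1}\mathsf B$. It is *bounded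 below* if $\mathsf T=\bigcup_{i\in\mathbb Z}\Sigma^i\mathsf A$ and *bounded above* if $\mathsf T=\bigcup_{i\in\mathbb Z}\Sigma^i\mathsf B$. Let $(\mathsf A,\mathsf B)$ be a co-t-structure in $\mathsf T$ whose co-heart $\mathsf C$ is almost silting, and let $s$ be a complement of $\mathsf C$. (i) Suppose $\mathrm{Hom}_{\mathsf T}(c,\Sigma^n s)=0$ for all $c\in\mathsf C$ and all $n\le 0$. Then $(\mathsf A,\mathsf B)$ is bounded above or bounded below. Moreover, $\Sigma^k s\in\mathsf B$ for some $k\in\mathbb Z$ if and only if $\Sigma^k s\in\mathsf B$ for all $k\in\mathbb Z$; in this case $(\mathsf A,\mathsf B)$ is bounded above. (ii) Suppose $\mathrm{Hom}_{\mathsf T}(s,\Sigma^n c)=0$ for all $c\in\mathsf C$ and all $n\le 0$. Then $(\mathsf A,\mathsf B)$ is bounded above or bounded below. Moreover, $\Sigma^k s\in\mathsf A$ for some $k\in\mathbb Z$ if and only if $\Sigma^k s\in\mathsf A$ for all $k\in\mathbb Z$; in this case $(\mathsf A,\mathsf B)$ is bounded below. -/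

import Mathlib

open CategoryTheory Limits Pretriangulated

universe v u

namespace Silting

section Additive

variable (T : Type u) [Category.{v} T] [Preadditive T] [HasFiniteBiproducts T]

/-- A category is Krull–Schmidt if every object is a finite direct sum of objects with
local endomorphism rings. -/
class IsKrullSchmidt : Prop where
  exists_decomposition (X : T) : ∃ (n : ℕ) (f : Fin n → T),
    (∀ i, IsLocalRing (End (f i))) ∧ Nonempty (X ≅ ⨁ f)

variable {T}

/-- `add P`: the direct summands (retracts) of finite direct sums of objects of `P`. -/
def add (P : ObjectProperty T) : ObjectProperty T := fun X ↦
  ∃ (n : ℕ) (f : Fin n → T), (∀ i, P (f i)) ∧ Nonempty (Retract X (⨁ f))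

end Additive

section Triangulated

variable (T : Type u) [Category.{v} T] [Preadditive T] [HasZeroObject T] [HasShift T ℤ]
  [∀ n : ℤ, (shiftFunctor T n).Additive] [Pretriangulated T]

/-- A co-t-structure `(A, B)` on a triangulated category with suspension `Σ = ⟦1⟧`. Both `A` and
`B` are closed under (isomorphisms and) direct summands, i.e. retracts, and under direct sums;
`Σ⁻¹A ⊆ A`, `ΣB ⊆ B`, `Hom(A, B) = 0`, and each object `t` sits in a distinguished triangle
`a ⟶ t ⟶ b ⟶ Σa` with `a` in `A` and `b` in `B`. -/
structure CoTStructure where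
  A : ObjectProperty T
  B : ObjectProperty T
  retract_A : A.IsStableUnderRetracts
  retract_B : B.IsStableUnderRetracts
  biprod_A {X Y : T} : A X → A Y → A (X ⊞ Y)
  biprod_B {X Y : T} : B X → B Y → B (X ⊞ Y)
  shift_A {X : T} : A X → A (X⟦(-1 : ℤ)⟧)
  shift_B {X : T} : B X → B (X⟦(1 : ℤ)⟧)
  hom_eq_zero {X Y : T} (f : X ⟶ Y) : A X → B Y → f = 0
  exists_triangle (t : T) : ∃ (a b : T) (_ : A a) (_ : B b)
    (f : a ⟶ t) (g : t ⟶ b) (h : b ⟶ a⟦(1 : ℤ)⟧), Triangle.mk f g h ∈ distTriang T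

variable {T}

/-- The co-heart `A ∩ Σ⁻¹B`; an object `X` lies in `Σ⁻¹B` if and only if `ΣX` lies in `B`. -/
def CoTStructure.coheart (τ : CoTStructure T) : ObjectProperty T := fun X ↦
  τ.A X ∧ τ.B (X⟦(1 : ℤ)⟧)

/-- Bounded below: every object lies in `Σ^i A` for some integer `i`, i.e. each object has a
shift lying in `A`. -/
def CoTStructure.BoundedBelow (τ : CoTStructure T) : Prop := ∀ X : T, ∃ i : ℤ, τ.A (X⟦i⟧)

/-- Bounded above: every object lies in `Σ^i B` for some integer `i`, i.e. each object has a
shift lying in `B`. -/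
def CoTStructure.BoundedAbove (τ : CoTStructure T) : Prop := ∀ X : T, ∃ i : ℤ, τ.B (X⟦i⟧)

/-- `S` is partial silting if `Hom(x, Σ^i y) = 0` for all `x`, `y` in `S` and all `i > 0`. -/
def IsPartialSilting (S : ObjectProperty T) : Prop :=
  ∀ ⦃X Y : T⦄, S X → S Y → ∀ i : ℤ, 0 < i → ∀ f : X ⟶ Y⟦i⟧, f = 0

/-- `S` is silting if it is partial silting and the smallest thick subcategory (triangulated
subcategory closed under direct summands) containing `S` is the whole category. -/
def IsSilting (S : ObjectProperty T) : Prop :=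
  IsPartialSilting S ∧ S.IsClassicalTriangulatedGenerator

/-- `s` is a complement of `S` if it is indecomposable and `add (S ∪ {s})` is silting. -/
def IsComplement (S : ObjectProperty T) (s : T) : Prop :=
  Indecomposable s ∧ IsSilting (add (S ⊔ ObjectProperty.singleton s))

/-- `S` is almost silting if it is partial silting and has a complement. -/
def IsAlmostSilting (S : ObjectProperty T) : Prop :=
  IsPartialSilting S ∧ ∃ s : T, IsComplement S s

end Triangulated

end Silting

namespace Silting

/-! ### Vanishing of morphism groups under retracts and shifts. -/

section Basic

variable {T : Type u} [Category.{v} T] [Preadditive T]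

/-- Every morphism from `X` to `Y` vanishes. -/
def HomZero (X Y : T) : Prop := ∀ f : X ⟶ Y, f = 0

lemma HomZero.of_retract_left {X X' Y : T} (h : HomZero X Y) (r : Retract X' X) :
    HomZero X' Y := fun f ↦ by
  rw [← Category.id_comp f, ← r.retract, Category.assoc, h (r.r ≫ f), comp_zero]

lemma HomZero.of_retract_right {X Y Y' : T} (h : HomZero X Y) (r : Retract Y' Y) :
    HomZero X Y' := fun f ↦ by
  rw [← Category.comp_id f, ← r.retract, ← Category.assoc, h (f ≫ r.i), zero_comp]

lemma HomZero.of_iso {X X' Y Y' : T} (h : HomZero X Y) (e : X' ≅ X) (e' : Y' ≅ Y) :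
    HomZero X' Y' :=
  (h.of_retract_left e.retract).of_retract_right e'.retract

lemma homZero_of_isZero_left {X Y : T} (h : IsZero X) : HomZero X Y := fun f ↦ h.eq_of_src f 0

lemma homZero_of_isZero_right {X Y : T} (h : IsZero Y) : HomZero X Y := fun f ↦ h.eq_of_tgt f 0

lemma isZero_of_homZero {X : T} (h : HomZero X X) : IsZero X := (IsZero.iff_id_eq_zero X).2 (h _)

variable [HasShift T ℤ] [∀ n : ℤ, (shiftFunctor T n).Additive]

lemma homZero_shift_iff (X Y : T) (a : ℤ) : HomZero (X⟦a⟧) (Y⟦a⟧) ↔ HomZero X Y := by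
  constructor
  · intro h f
    apply (shiftFunctor T a).map_injective
    rw [h ((shiftFunctor T a).map f), Functor.map_zero]
  · intro h f
    obtain ⟨g, rfl⟩ := (shiftFunctor T a).map_surjective f
    rw [h g, Functor.map_zero]

lemma HomZero.shift {X Y : T} {a b c d : ℤ} (h : HomZero (X⟦a⟧) (Y⟦b⟧))
    (e : b + c = d + a) : HomZero (X⟦c⟧) (Y⟦d⟧) := by
  rw [← homZero_shift_iff _ _ (c - a)] at h
  exact h.of_iso ((shiftFunctorAdd' T a (c - a) c (by lia)).app X)
    ((shiftFunctorAdd' T b (c - a) d (by lia)).app Y)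

lemma HomZero.shift_left {X Y : T} {b c d : ℤ} (h : HomZero X (Y⟦b⟧))
    (e : b + c = d) : HomZero (X⟦c⟧) (Y⟦d⟧) :=
  HomZero.shift (a := 0) (h.of_iso ((shiftFunctorZero T ℤ).app X) (Iso.refl _)) (by lia)

lemma HomZero.shift_right {X Y : T} {a c d : ℤ} (h : HomZero (X⟦a⟧) Y)
    (e : a + d = c) : HomZero (X⟦c⟧) (Y⟦d⟧) :=
  HomZero.shift (b := 0) (h.of_iso (Iso.refl _) ((shiftFunctorZero T ℤ).app Y)) (by lia)

end Basic

lemma isStableUnderShift_retractClosure {C : Type*} [Category* C] [HasShift C ℤ]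
    (P : ObjectProperty C) [P.IsStableUnderShift ℤ] :
    P.retractClosure.IsStableUnderShift ℤ where
  isStableUnderShiftBy a := ⟨by
    rintro X ⟨Y, hY, ⟨r⟩⟩
    exact ⟨Y⟦a⟧, P.le_shift a _ hY, ⟨r.map (shiftFunctor C a)⟩⟩⟩

/-! ### Extensions and retracts in a triangulated category. -/

section Extension

variable {T : Type u} [Category.{v} T] [Preadditive T] [HasZeroObject T] [HasShift T ℤ]
  [∀ n : ℤ, (shiftFunctor T n).Additive] [Pretriangulated T]

/-- If the second map of a distinguished triangle vanishes, the middle object is a retract of the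
first one. -/
lemma retract_obj₂_obj₁ (S : Triangle T) (hS : S ∈ distTriang T) (h : S.mor₂ = 0) :
    Nonempty (Retract S.obj₂ S.obj₁) := by
  obtain ⟨i, hi⟩ := S.coyoneda_exact₂ hS (𝟙 _) (by rw [h, comp_zero])
  exact ⟨⟨i, S.mor₁, hi.symm⟩⟩

/-- If the first map of a distinguished triangle vanishes, the middle object is a retract of the
third one. -/
lemma retract_obj₂_obj₃ (S : Triangle T) (hS : S ∈ distTriang T) (h : S.mor₁ = 0) :
    Nonempty (Retract S.obj₂ S.obj₃) := by
  obtain ⟨r, hr⟩ := S.yoneda_exact₂ hS (𝟙 _) (by rw [h, zero_comp])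
  exact ⟨⟨S.mor₂, r, hr.symm⟩⟩

open ObjectProperty

/-- A triangle q → x → p has zero connecting map, so it splits and the summands may be exchanged. -/
lemma extensionProduct_swap_le {P Q : ObjectProperty T}
    (h : ∀ p q, P p → Q q → HomZero p (q⟦(1 : ℤ)⟧)) :
    extensionProduct Q P ≤ extensionProduct P Q := by
  rintro X ⟨q, p, f, g, k, hT, hq, hp⟩
  obtain ⟨e, -⟩ := exists_iso_binaryBiproduct_of_distTriang _ hT (h p q hp hq k)
  exact (extensionProduct P Q).prop_of_iso (e ≪≫ biprod.braiding _ _).symm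
    ⟨_, _, _, _, _, binaryBiproductTriangle_distinguished p q, hp, hq⟩

lemma isTriangulatedClosed₂_extensionProduct [IsTriangulated T] {P Q : ObjectProperty T}
    [P.IsTriangulatedClosed₂] [Q.IsTriangulatedClosed₂] [P.IsClosedUnderIsomorphisms]
    [Q.IsClosedUnderIsomorphisms]
    (h : ∀ p q, P p → Q q → HomZero p (q⟦(1 : ℤ)⟧)) :
    (extensionProduct P Q).IsTriangulatedClosed₂ := by
  refine .mk' fun S hS h₁ h₃ ↦ ?_
  have key : extensionProduct (extensionProduct P Q) (extensionProduct P Q) ≤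
      extensionProduct P Q := by
    calc extensionProduct (extensionProduct P Q) (extensionProduct P Q)
        = extensionProduct P (extensionProduct (extensionProduct Q P) Q) := by
          simp only [extensionProduct_assoc]
      _ ≤ extensionProduct P (extensionProduct (extensionProduct P Q) Q) :=
          monotone_extensionProduct_right _
            (monotone_extensionProduct_left _ (extensionProduct_swap_le h))
      _ = extensionProduct (extensionProduct P P) (extensionProduct Q Q) := by
          simp only [extensionProduct_assoc]
      _ ≤ extensionProduct P (extensionProduct Q Q) :=
          monotone_extensionProduct_left _
            (extensionProduct_le_of_isTriangulatedClosed₂ le_rfl le_rfl)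
      _ ≤ extensionProduct P Q :=
          monotone_extensionProduct_right _
            (extensionProduct_le_of_isTriangulatedClosed₂ le_rfl le_rfl)
  exact key _ ⟨_, _, _, _, _, hS, h₁, h₃⟩

lemma isTriangulatedClosed₂_retractClosure (P : ObjectProperty T)
    [P.IsTriangulatedClosed₂] [P.IsClosedUnderIsomorphisms] :
    P.retractClosure.IsTriangulatedClosed₂ :=
  .mk' fun _ hS h₁ h₃ ↦ monotone_retractClosure
    (extensionProduct_le_of_isTriangulatedClosed₂ le_rfl le_rfl) _
    (extensionProduct_retractClosure_retractClosure_le P P _ ⟨_, _, _, _, _, hS, h₁, h₃⟩)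

/-- If `t` is a retract of an object of a triangulated subcategory `D`, then `t ⊞ t⟦1⟧` belongs
to `D`. -/
lemma biprod_shift_mem_of_retract [IsTriangulated T] (D : ObjectProperty T) [D.IsTriangulated]
    [D.IsClosedUnderIsomorphisms] {t w : T} (hw : D w) (r : Retract t w) :
    D (t ⊞ t⟦(1 : ℤ)⟧) := by
  obtain ⟨z, p, h, hT⟩ := distinguished_cocone_triangle r.i
  have hh : h = 0 := (Triangle.mor₃_eq_zero_iff_mono₁ _ hT).2
    (show Mono r.i from (SplitMono.mk r.r r.retract).mono)
  obtain ⟨e, -⟩ := exists_iso_binaryBiproduct_of_distTriang _ hT hh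
  have hw' : D (t ⊞ z) := D.prop_of_iso e hw
  have h₁ := rot_of_distTriang _ (binaryBiproductTriangle_distinguished t z)
  have h₂ : Triangle.mk (biprod.inr : z ⟶ t ⊞ z) biprod.fst 0 ∈ distTriang T :=
    isomorphic_distinguished _ (binaryBiproductTriangle_distinguished z t) _
      (Triangle.isoMk _ _ (Iso.refl _) (biprod.braiding _ _) (Iso.refl _)
        (show biprod.inr ≫ (biprod.braiding t z).hom = 𝟙 z ≫ biprod.inl by ext <;> simp)
        (show biprod.fst ≫ 𝟙 t = (biprod.braiding t z).hom ≫ biprod.snd by simp)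
        (show (0 : t ⟶ z⟦(1 : ℤ)⟧) ≫ _ = 𝟙 t ≫ 0 from zero_comp.trans comp_zero.symm))
  -- The idempotent of `t ⊞ z` with image `z` has its cone `y` in `D`. The octahedral axiom for
  -- `snd` followed by `inr` presents `y` as an extension of `t` by `t⟦1⟧` with zero connecting map.
  obtain ⟨y, a, b, h₃⟩ :=
    distinguished_cocone_triangle ((biprod.snd : t ⊞ z ⟶ z) ≫ (biprod.inr : z ⟶ t ⊞ z))
  have hy : D y := D.ext_of_isTriangulatedClosed₃ _ h₃ hw' hw'
  have o := (Triangulated.someOctahedron rfl h₁ h₂ h₃).mem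
  obtain ⟨e', -⟩ := exists_iso_binaryBiproduct_of_distTriang _ o zero_comp
  exact D.prop_of_iso (e' ≪≫ biprod.braiding _ _) hy

end Extension

end Silting

namespace Silting

/-! ### Classes of objects defined by eventual behaviour of their shifts. -/

section EventualShift

open ObjectProperty Filter ZeroObject

variable {T : Type u} [Category.{v} T] [HasShift T ℤ]

/-- The objects whose shifts `t⟦n⟧` satisfy `P` eventually along the filter `l`. -/
def evShift (l : Filter ℤ) (P : ObjectProperty T) : ObjectProperty T :=
  fun t ↦ ∀ᶠ n in l, P (t⟦n⟧)

instance (l : Filter ℤ) (P : ObjectProperty T) [P.IsClosedUnderIsomorphisms] :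
    (evShift l P).IsClosedUnderIsomorphisms where
  of_iso e h := h.mono fun n hn ↦ P.prop_of_iso ((shiftFunctor T n).mapIso e) hn

instance (l : Filter ℤ) (P : ObjectProperty T) [P.IsStableUnderRetracts] :
    (evShift l P).IsStableUnderRetracts where
  of_retract r h := h.mono fun n hn ↦ P.prop_of_retract (r.map (shiftFunctor T n)) hn

lemma isStableUnderShift_evShift {l : Filter ℤ} (hl : ∀ a : ℤ, Tendsto (a + ·) l l)
    (P : ObjectProperty T) [P.IsClosedUnderIsomorphisms] :
    (evShift l P).IsStableUnderShift ℤ where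
  isStableUnderShiftBy a := ⟨fun X hX ↦ ((hl a).eventually hX).mono fun n hn ↦
    P.prop_of_iso ((shiftFunctorAdd T a n).app X) hn⟩

variable [Preadditive T] [HasZeroObject T]
  [∀ n : ℤ, (shiftFunctor T n).Additive] [Pretriangulated T]

instance (l : Filter ℤ) (P : ObjectProperty T) [P.IsClosedUnderIsomorphisms]
    [P.IsTriangulatedClosed₂] : (evShift l P).IsTriangulatedClosed₂ :=
  .mk' fun S hS h₁ h₃ ↦ by
    filter_upwards [h₁, h₃] with n hn₁ hn₃
    exact P.ext_of_isTriangulatedClosed₂ _ (Triangle.shift_distinguished S hS n) hn₁ hn₃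

instance (l : Filter ℤ) (P : ObjectProperty T) [P.IsClosedUnderIsomorphisms]
    [P.ContainsZero] : (evShift l P).ContainsZero where
  exists_zero := ⟨0, isZero_zero T, .of_forall fun _ ↦
    P.prop_of_isZero (Functor.map_isZero _ (isZero_zero T))⟩

/-- Translation invariance of the filter supplies stability under all shifts, so an extension-closed
`P`, itself perhaps stable under shifts in one direction only, yields a triangulated subcategory. -/
lemma isTriangulated_evShift {l : Filter ℤ} (hl : ∀ a : ℤ, Tendsto (a + ·) l l)
    (P : ObjectProperty T) [P.IsClosedUnderIsomorphisms]
    [P.IsTriangulatedClosed₂] [P.ContainsZero] : (evShift l P).IsTriangulated where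
  toIsStableUnderShift := isStableUnderShift_evShift hl P

instance (P : ObjectProperty T) [P.IsClosedUnderIsomorphisms]
    [P.IsTriangulatedClosed₂] [P.ContainsZero] : (evShift ⊤ P).IsTriangulated :=
  isTriangulated_evShift (fun _ ↦ tendsto_top) P

instance (P : ObjectProperty T) [P.IsClosedUnderIsomorphisms]
    [P.IsTriangulatedClosed₂] [P.ContainsZero] : (evShift atTop P).IsTriangulated :=
  isTriangulated_evShift (fun a ↦ tendsto_atTop_add_const_left _ a tendsto_id) P

instance (P : ObjectProperty T) [P.IsClosedUnderIsomorphisms]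
    [P.IsTriangulatedClosed₂] [P.ContainsZero] : (evShift atBot P).IsTriangulated :=
  isTriangulated_evShift (fun a ↦ tendsto_atBot_add_const_left _ a tendsto_id) P

end EventualShift

/-! ### Co-t-structures, orthogonality and bounded objects. -/

namespace CoTStructure

open ObjectProperty Filter ZeroObject

variable {T : Type u} [Category.{v} T] [Preadditive T] [HasZeroObject T] [HasShift T ℤ]
  [∀ n : ℤ, (shiftFunctor T n).Additive] [Pretriangulated T] (τ : CoTStructure T)

instance : τ.A.IsStableUnderRetracts := τ.retract_A

instance : τ.B.IsStableUnderRetracts := τ.retract_B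

lemma mem_A_of_homZero {t : T} (h : ∀ b, τ.B b → HomZero t b) : τ.A t := by
  obtain ⟨a, b, ha, hb, f, g, k, hT⟩ := τ.exists_triangle t
  obtain ⟨r⟩ := retract_obj₂_obj₁ _ hT (h b hb g)
  exact τ.A.prop_of_retract r ha

lemma mem_B_of_homZero {t : T} (h : ∀ a, τ.A a → HomZero a t) : τ.B t := by
  obtain ⟨a, b, ha, hb, f, g, k, hT⟩ := τ.exists_triangle t
  obtain ⟨r⟩ := retract_obj₂_obj₃ _ hT (h a ha f)
  exact τ.B.prop_of_retract r hb

lemma A_eq : τ.A = τ.B.leftOrthogonal :=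
  le_antisymm (fun _ hX _ f hY ↦ τ.hom_eq_zero f hX hY)
    fun _ hX ↦ τ.mem_A_of_homZero fun _ hb f ↦ hX f hb

lemma B_eq : τ.B = τ.A.rightOrthogonal :=
  le_antisymm (fun _ hX _ f hY ↦ τ.hom_eq_zero f hY hX)
    fun _ hX ↦ τ.mem_B_of_homZero fun _ hb f ↦ hX f hb

instance : τ.A.IsTriangulatedClosed₂ := by rw [A_eq]; infer_instance

instance : τ.B.IsTriangulatedClosed₂ := by rw [B_eq]; infer_instance

lemma mem_A_of_isZero {X : T} (h : IsZero X) : τ.A X :=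
  τ.mem_A_of_homZero fun _ _ ↦ homZero_of_isZero_left h

lemma mem_B_of_isZero {X : T} (h : IsZero X) : τ.B X :=
  τ.mem_B_of_homZero fun _ _ ↦ homZero_of_isZero_right h

instance : τ.A.ContainsZero := ⟨0, isZero_zero T, τ.mem_A_of_isZero (isZero_zero T)⟩

instance : τ.B.ContainsZero := ⟨0, isZero_zero T, τ.mem_B_of_isZero (isZero_zero T)⟩

lemma A_shift_of_le {X : T} {m n : ℤ} (h : τ.A (X⟦n⟧)) (hmn : m ≤ n) : τ.A (X⟦m⟧) := by
  induction m, hmn using Int.leInductionDown with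
  | base => exact h
  | pred m _ ih =>
    exact τ.A.prop_of_iso ((shiftFunctorAdd' T m (-1) (m - 1) (by lia)).symm.app X)
      (τ.shift_A ih)

lemma B_shift_of_le {X : T} {m n : ℤ} (h : τ.B (X⟦m⟧)) (hmn : m ≤ n) : τ.B (X⟦n⟧) := by
  induction n, hmn using Int.leInduction with
  | base => exact h
  | succ n _ ih =>
    exact τ.B.prop_of_iso ((shiftFunctorAdd' T n 1 (n + 1) rfl).symm.app X) (τ.shift_B ih)

/-- The objects with a shift in `A`. -/
abbrev minus : ObjectProperty T := evShift atBot τ.A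

/-- The objects with a shift in `B`. -/
abbrev plus : ObjectProperty T := evShift atTop τ.B

/-- The objects with a shift in `A` and a shift in `B`. -/
abbrev bounded : ObjectProperty T := τ.minus ⊓ τ.plus

lemma minus_iff {X : T} : τ.minus X ↔ ∃ i : ℤ, τ.A (X⟦i⟧) :=
  ⟨fun h ↦ h.exists, fun ⟨i, hi⟩ ↦ eventually_atBot.2 ⟨i, fun _ h ↦ τ.A_shift_of_le hi h⟩⟩

lemma plus_iff {X : T} : τ.plus X ↔ ∃ i : ℤ, τ.B (X⟦i⟧) :=
  ⟨fun h ↦ h.exists, fun ⟨i, hi⟩ ↦ eventually_atTop.2 ⟨i, fun _ h ↦ τ.B_shift_of_le hi h⟩⟩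

lemma minus_of_A {X : T} (h : τ.A X) : τ.minus X :=
  τ.minus_iff.2 ⟨0, τ.A.prop_of_iso ((shiftFunctorZero T ℤ).symm.app X) h⟩

lemma plus_of_B {X : T} (h : τ.B X) : τ.plus X :=
  τ.plus_iff.2 ⟨0, τ.B.prop_of_iso ((shiftFunctorZero T ℤ).symm.app X) h⟩

lemma boundedAbove_of_le (h : τ.minus ≤ τ.plus) : τ.BoundedAbove := fun t ↦ by
  obtain ⟨a, b, ha, hb, f, g, k, hT⟩ := τ.exists_triangle t
  exact τ.plus_iff.1 (τ.plus.ext_of_isTriangulatedClosed₂ _ hT (h _ (τ.minus_of_A ha))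
    (τ.plus_of_B hb))

lemma boundedBelow_of_le (h : τ.plus ≤ τ.minus) : τ.BoundedBelow := fun t ↦ by
  obtain ⟨a, b, ha, hb, f, g, k, hT⟩ := τ.exists_triangle t
  exact τ.minus_iff.1 (τ.minus.ext_of_isTriangulatedClosed₂ _ hT (τ.minus_of_A ha)
    (h _ (τ.plus_of_B hb)))

lemma coheart_le_bounded : τ.coheart ≤ τ.bounded := fun _ h ↦
  ⟨τ.minus_of_A h.1, τ.plus_iff.2 ⟨1, h.2⟩⟩

/-- Truncating ΣX as a → ΣX → b makes Σ⁻¹b an object of the co-heart and shortens the range of `a`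
by one, so induction applies to `a`. -/
lemma mem_of_A_of_B_shift {Q : ObjectProperty T} [Q.IsTriangulated]
    [Q.IsClosedUnderIsomorphisms] (hQ : τ.coheart ≤ Q) (n : ℕ) :
    ∀ {X : T}, τ.A X → τ.B (X⟦(n : ℤ)⟧) → Q X := by
  induction n with
  | zero =>
    intro X hA hB
    exact Q.prop_of_isZero (isZero_of_homZero fun f ↦ τ.hom_eq_zero f hA
      (τ.B.prop_of_iso ((shiftFunctorZero T ℤ).app X) hB))
  | succ n ih =>
    intro X hA hB
    -- Below, `b⟦n - 1⟧` has to lie in `B`, which needs `n ≥ 1`; for `n = 0` the object is already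
    -- in the co-heart.
    obtain rfl | hn := Nat.eq_zero_or_pos n
    · exact hQ _ ⟨hA, hB⟩
    obtain ⟨a, b, ha, hb, f, g, k, hT⟩ := τ.exists_triangle (X⟦(1 : ℤ)⟧)
    rw [← Q.prop_shift_iff_of_isStableUnderShift X (1 : ℤ)]
    refine Q.ext_of_isTriangulatedClosed₂ _ hT (ih ha ?_) ?_
    · refine τ.B.ext_of_isTriangulatedClosed₂ _
        (Triangle.shift_distinguished _ (inv_rot_of_distTriang _ hT) n) ?_ ?_
      · exact τ.B.prop_of_iso ((shiftFunctorAdd' T (-1) (n : ℤ) (n - 1) (by lia)).app b)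
          (τ.B_shift_of_le (m := 0)
            (τ.B.prop_of_iso ((shiftFunctorZero T ℤ).symm.app b) hb) (by lia))
      · exact τ.B.prop_of_iso ((shiftFunctorAdd' T 1 (n : ℤ) (n + 1 : ℕ) (by lia)).app X) hB
    · refine (Q.prop_shift_iff_of_isStableUnderShift b (-1 : ℤ)).1 ?_
      refine hQ _ ⟨?_, τ.B.prop_of_iso ((shiftShiftNeg b (-1 : ℤ)).symm ≪≫ Iso.refl _) hb⟩
      refine τ.A.ext_of_isTriangulatedClosed₂ _
        (Triangle.shift_distinguished _ (rot_of_distTriang _ hT) (-1)) ?_ ?_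
      · exact τ.A.prop_of_iso ((shiftShiftNeg X (1 : ℤ)).symm) hA
      · exact τ.A.prop_of_iso ((shiftShiftNeg a (1 : ℤ)).symm) ha

lemma bounded_le {Q : ObjectProperty T} [Q.IsTriangulated]
    [Q.IsClosedUnderIsomorphisms] (hQ : τ.coheart ≤ Q) : τ.bounded ≤ Q := by
  rintro X ⟨h₁, h₂⟩
  obtain ⟨i, hi⟩ := τ.minus_iff.1 h₁
  obtain ⟨j, hj⟩ := τ.plus_iff.1 h₂
  rw [← Q.prop_shift_iff_of_isStableUnderShift X i]
  refine τ.mem_of_A_of_B_shift hQ (j - i).toNat hi (τ.B.prop_of_iso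
    ((shiftFunctorAdd' T i ((j - i).toNat : ℤ) (i + (j - i).toNat) rfl).app X) ?_)
  exact τ.B_shift_of_le hj (by lia)

/-- A morphism from an object of `minus` to an object of `plus` factors through a bounded
object. -/
lemma exists_factorization {X Y : T} (hX : τ.minus X) (hY : τ.plus Y) (f : X ⟶ Y) :
    ∃ (c : T) (_ : τ.bounded c) (p : X ⟶ c) (q : c ⟶ Y), f = p ≫ q := by
  obtain ⟨m, hm⟩ := τ.plus_iff.1 hY
  -- With `Y⟦m⟧` in `B`, the map `f⟦m⟧'` kills `a` and factors through `b`, which is bounded because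
  -- `X` and `a` both have a shift in `A`.
  obtain ⟨a, b, ha, hb, i, g, k, hT⟩ := τ.exists_triangle (X⟦m⟧)
  obtain ⟨q, hq⟩ := Triangle.yoneda_exact₂ _ hT (f⟦m⟧') (τ.hom_eq_zero _ ha hm)
  have hc : τ.bounded b := ⟨τ.minus.ext_of_isTriangulatedClosed₃ _ hT (τ.minus_of_A ha)
    (τ.minus.le_shift m _ hX), τ.plus_of_B hb⟩
  let e := (shiftFunctorCompIsoId T m (-m) (add_neg_cancel m)).app X
  let e' := (shiftFunctorCompIsoId T m (-m) (add_neg_cancel m)).app Y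
  refine ⟨b⟦-m⟧, τ.bounded.le_shift (-m) _ hc, e.inv ≫ g⟦-m⟧', q⟦-m⟧' ≫ e'.hom, ?_⟩
  have h : f⟦m⟧'⟦-m⟧' = g⟦-m⟧' ≫ q⟦-m⟧' := by
    rw [hq]
    exact (shiftFunctor T (-m)).map_comp g q
  rw [Category.assoc, ← Category.assoc (g⟦-m⟧'), ← h, shift_shift_neg']
  simp [e, e']

end CoTStructure

end Silting

namespace Silting

/-! ### Finite generation of Hom over the endomorphism ring of s. -/

section FiniteGeneration

variable {T : Type u} [Category.{v} T] [Preadditive T]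

/-- The family `g` generates `Hom(X, s)` as a left module over the endomorphisms of `s`. -/
def GeneratesLeft {X s : T} {n : ℕ} (g : Fin n → (X ⟶ s)) : Prop :=
  ∀ f : X ⟶ s, ∃ r : Fin n → (s ⟶ s), f = ∑ i, g i ≫ r i

/-- The family `g` generates `Hom(s, Y)` as a right module over the endomorphisms of `s`. -/
def GeneratesRight {s Y : T} {n : ℕ} (g : Fin n → (s ⟶ Y)) : Prop :=
  ∀ f : s ⟶ Y, ∃ r : Fin n → (s ⟶ s), f = ∑ i, r i ≫ g i

/-- `Hom(X, s)` is finitely generated over the endomorphisms of `s`. -/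
def FGLeft (s : T) : ObjectProperty T := fun X ↦
  ∃ (n : ℕ) (g : Fin n → (X ⟶ s)), GeneratesLeft g

/-- `Hom(s, Y)` is finitely generated over the endomorphisms of `s`. -/
def FGRight (s : T) : ObjectProperty T := fun Y ↦
  ∃ (n : ℕ) (g : Fin n → (s ⟶ Y)), GeneratesRight g

lemma fgLeft_of_homZero {X s : T} (h : HomZero X s) : FGLeft s X :=
  ⟨0, Fin.elim0, fun f ↦ ⟨Fin.elim0, by simp [h f]⟩⟩

lemma fgRight_of_homZero {s Y : T} (h : HomZero s Y) : FGRight s Y :=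
  ⟨0, Fin.elim0, fun f ↦ ⟨Fin.elim0, by simp [h f]⟩⟩

lemma fgLeft_self (s : T) : FGLeft s s := ⟨1, fun _ ↦ 𝟙 s, fun f ↦ ⟨fun _ ↦ f, by simp⟩⟩

lemma fgRight_self (s : T) : FGRight s s := ⟨1, fun _ ↦ 𝟙 s, fun f ↦ ⟨fun _ ↦ f, by simp⟩⟩

instance (s : T) : (FGLeft s).IsStableUnderRetracts where
  of_retract := by
    rintro X Y ρ ⟨n, g, hg⟩
    refine ⟨n, fun i ↦ ρ.i ≫ g i, fun f ↦ ?_⟩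
    obtain ⟨r, hr⟩ := hg (ρ.r ≫ f)
    exact ⟨r, by simpa [Preadditive.comp_sum] using ρ.i ≫= hr⟩

instance (s : T) : (FGRight s).IsStableUnderRetracts where
  of_retract := by
    rintro X Y ρ ⟨n, g, hg⟩
    refine ⟨n, fun i ↦ g i ≫ ρ.r, fun f ↦ ?_⟩
    obtain ⟨r, hr⟩ := hg (f ≫ ρ.i)
    exact ⟨r, by simpa [Preadditive.sum_comp] using hr =≫ ρ.r⟩

/-- A generating family of minimal cardinality satisfies no relation with an invertible
coefficient. -/
lemma FGLeft.exists_minimal {s X : T} (h : FGLeft s X) :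
    ∃ (n : ℕ) (g : Fin n → (X ⟶ s)), GeneratesLeft g ∧
      ∀ r : Fin n → (s ⟶ s), ∑ i, g i ≫ r i = 0 → ∀ i, ¬ IsIso (r i) := by
  classical
  obtain ⟨g, hg⟩ := Nat.find_spec h
  have hmin := fun m ↦ Nat.find_min h (m := m)
  generalize Nat.find h = n at g hmin
  refine ⟨n, g, hg, fun r hr i hi ↦ ?_⟩
  obtain _ | n := n
  · exact i.elim0
  refine hmin n n.lt_succ_self ⟨fun j ↦ g (i.succAbove j), fun f ↦ ?_⟩
  obtain ⟨t, rfl⟩ := hg f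
  refine ⟨fun j ↦ t (i.succAbove j) - r (i.succAbove j) ≫ inv (r i) ≫ t i, ?_⟩
  rw [Fin.sum_univ_succAbove _ i] at hr ⊢
  -- The relation is solved for `g i`, leaving a smaller generating family.
  have hi' : g i ≫ t i = -∑ j, g (i.succAbove j) ≫ r (i.succAbove j) ≫ inv (r i) ≫ t i := by
    rw [← IsIso.hom_inv_id_assoc (r i) (t i), ← Category.assoc, eq_neg_of_add_eq_zero_left hr]
    simp [Preadditive.sum_comp]
  rw [hi']
  simp only [Preadditive.comp_sub, Finset.sum_sub_distrib]
  abel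

/-- A generating family of minimal cardinality satisfies no relation with an invertible
coefficient. -/
lemma FGRight.exists_minimal {s Y : T} (h : FGRight s Y) :
    ∃ (n : ℕ) (g : Fin n → (s ⟶ Y)), GeneratesRight g ∧
      ∀ r : Fin n → (s ⟶ s), ∑ i, r i ≫ g i = 0 → ∀ i, ¬ IsIso (r i) := by
  classical
  obtain ⟨g, hg⟩ := Nat.find_spec h
  have hmin := fun m ↦ Nat.find_min h (m := m)
  generalize Nat.find h = n at g hmin
  refine ⟨n, g, hg, fun r hr i hi ↦ ?_⟩
  obtain _ | n := n
  · exact i.elim0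
  refine hmin n n.lt_succ_self ⟨fun j ↦ g (i.succAbove j), fun f ↦ ?_⟩
  obtain ⟨t, rfl⟩ := hg f
  refine ⟨fun j ↦ t (i.succAbove j) - t i ≫ inv (r i) ≫ r (i.succAbove j), ?_⟩
  rw [Fin.sum_univ_succAbove _ i] at hr ⊢
  have hi' : t i ≫ g i = -∑ j, (t i ≫ inv (r i) ≫ r (i.succAbove j)) ≫ g (i.succAbove j) := by
    rw [← IsIso.inv_hom_id_assoc (r i) (g i), eq_neg_of_add_eq_zero_left hr]
    simp [Preadditive.comp_sum]
  rw [hi']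
  simp only [Preadditive.sub_comp, Finset.sum_sub_distrib]
  abel

lemma homZero_biproduct_left [HasFiniteBiproducts T] {n : ℕ} {X Y : T} (h : HomZero X Y) :
    HomZero (⨁ fun _ : Fin n ↦ X) Y := fun f ↦ by
  ext i
  exact (h _).trans comp_zero.symm

lemma homZero_biproduct_right [HasFiniteBiproducts T] {n : ℕ} {X Y : T} (h : HomZero X Y) :
    HomZero X (⨁ fun _ : Fin n ↦ Y) := fun f ↦ by
  ext i
  exact (h _).trans zero_comp.symm

variable [HasZeroObject T] [HasShift T ℤ]
  [∀ n : ℤ, (shiftFunctor T n).Additive] [Pretriangulated T]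

/-- Horseshoe argument: the vanishing hypothesis extends the generators on `obj₁` to `obj₂`, and
those on `obj₃` are pulled back. -/
lemma fgLeft_obj₂ {s : T} (S : Triangle T) (hS : S ∈ distTriang T) (h₁ : FGLeft s S.obj₁)
    (h₃ : FGLeft s S.obj₃) (h : HomZero S.obj₃ (s⟦(1 : ℤ)⟧)) : FGLeft s S.obj₂ := by
  obtain ⟨n, g, hg⟩ := h₁
  obtain ⟨m, k, hk⟩ := h₃
  have lift (f : S.obj₁ ⟶ s) : ∃ f' : S.obj₂ ⟶ s, f = S.mor₁ ≫ f' :=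
    Triangle.yoneda_exact₂ _ (inv_rot_of_distTriang _ hS) f
      (HomZero.of_retract_right (h.shift_left (c := -1) (d := 0) (by lia))
        ((shiftFunctorZero T ℤ).symm.app s).retract _)
  choose g' hg' using fun i ↦ lift (g i)
  refine ⟨n + m, Fin.append g' (fun j ↦ S.mor₂ ≫ k j), fun f ↦ ?_⟩
  obtain ⟨r, hr⟩ := hg (S.mor₁ ≫ f)
  obtain ⟨f₃, hf₃⟩ := S.yoneda_exact₂ hS (f - ∑ i, g' i ≫ r i) (by
    simp only [Preadditive.comp_sub, Preadditive.comp_sum, hr, ← Category.assoc, ← hg', sub_self])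
  obtain ⟨t, ht⟩ := hk f₃
  refine ⟨Fin.append r t, ?_⟩
  rw [Fin.sum_univ_add]
  simp only [Fin.append_left, Fin.append_right, Category.assoc, ← Preadditive.comp_sum]
  rw [← ht, ← hf₃]
  abel

lemma fgRight_obj₂ {s : T} (S : Triangle T) (hS : S ∈ distTriang T) (h₁ : FGRight s S.obj₁)
    (h₃ : FGRight s S.obj₃) (h : HomZero s (S.obj₁⟦(1 : ℤ)⟧)) : FGRight s S.obj₂ := by
  obtain ⟨n, g, hg⟩ := h₁
  obtain ⟨m, k, hk⟩ := h₃
  choose k' hk' using fun i ↦ S.coyoneda_exact₃ hS (k i) (h _)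
  refine ⟨n + m, Fin.append (fun j ↦ g j ≫ S.mor₁) k', fun f ↦ ?_⟩
  obtain ⟨r, hr⟩ := hk (f ≫ S.mor₂)
  obtain ⟨f₁, hf₁⟩ := S.coyoneda_exact₂ hS (f - ∑ i, r i ≫ k' i) (by
    simp only [Preadditive.sub_comp, Preadditive.sum_comp, hr, Category.assoc, ← hk', sub_self])
  obtain ⟨t, ht⟩ := hg f₁
  refine ⟨Fin.append t r, ?_⟩
  rw [Fin.sum_univ_add]
  simp only [Fin.append_left, Fin.append_right, ← Category.assoc, ← Preadditive.sum_comp]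
  rw [← ht, ← hf₁]
  abel

end FiniteGeneration

end Silting

namespace Silting

section Orthogonal

open ObjectProperty

variable {T : Type u} [Category.{v} T] [Preadditive T]

instance (P : ObjectProperty T) : P.leftOrthogonal.IsStableUnderRetracts where
  of_retract r h _ f hY := HomZero.of_retract_left (fun g ↦ h g hY) r f

instance (P : ObjectProperty T) : P.rightOrthogonal.IsStableUnderRetracts where
  of_retract r h _ f hY := HomZero.of_retract_right (fun g ↦ h g hY) r f

end Orthogonal

section Biproduct

open ObjectProperty

variable {T : Type u} [Category.{v} T] [Preadditive T] [HasZeroObject T] [HasShift T ℤ]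
  [∀ n : ℤ, (shiftFunctor T n).Additive] [Pretriangulated T]

lemma prop_biproduct (P : ObjectProperty T) [P.IsTriangulated] [P.IsClosedUnderIsomorphisms]
    {n : ℕ} {f : Fin n → T} (hf : ∀ i, P (f i)) : P (⨁ f) :=
  P.prop_of_isLimit_fan (biproduct.isLimit f) hf

end Biproduct

/-! ### Weight decompositions with respect to a presilting object. -/

section Weight

open ObjectProperty Filter

variable {T : Type u} [Category.{v} T] [Preadditive T] [HasShift T ℤ]

/-- A presilting object: there are no nonzero morphisms from `s` to its positive shifts. -/
class IsPresilting (s : T) : Prop where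
  homZero : ∀ j : ℤ, 0 < j → HomZero s (s⟦j⟧)

/-- The objects without nonzero morphisms to the positive shifts of `s`. -/
def weightLE (s : T) : ObjectProperty T := fun x ↦ ∀ j : ℤ, 0 < j → HomZero x (s⟦j⟧)

/-- The objects without nonzero morphisms from the nonpositive shifts of `s`. -/
def weightGT (s : T) : ObjectProperty T := fun v ↦ ∀ j : ℤ, j ≤ 0 → HomZero (s⟦j⟧) v

/-- The left part of the weight decompositions for `s`. -/
def weightLeft (s : T) : ObjectProperty T := (weightGT s).leftOrthogonal ⊓ FGLeft s

/-- The right part of the weight decompositions for `s`. -/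
def weightRight (s : T) : ObjectProperty T :=
  (weightLE s).rightOrthogonal ⊓ FGRight (s⟦(1 : ℤ)⟧)

instance (s : T) : (weightLeft s).IsStableUnderRetracts where
  of_retract r h := ⟨prop_of_retract _ r h.1, prop_of_retract _ r h.2⟩

instance (s : T) : (weightRight s).IsStableUnderRetracts where
  of_retract r h := ⟨prop_of_retract _ r h.1, prop_of_retract _ r h.2⟩

variable [∀ n : ℤ, (shiftFunctor T n).Additive] (s : T)

lemma shift_mem_weightGT [hs : IsPresilting s] {j : ℤ} (hj : 0 < j) : weightGT s (s⟦j⟧) :=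
  fun i hi ↦ (hs.homZero (j - i) (by lia)).shift_left (by lia)

lemma shift_mem_weightLE [hs : IsPresilting s] {j : ℤ} (hj : j ≤ 0) : weightLE s (s⟦j⟧) :=
  fun i hi ↦ (hs.homZero (i - j) (by lia)).shift_left (by lia)

lemma weightLE_of_leftOrthogonal [IsPresilting s] {x : T} (hx : (weightGT s).leftOrthogonal x) :
    weightLE s x := fun _ hj f ↦ hx f (shift_mem_weightGT s hj)

lemma weightGT_of_rightOrthogonal [IsPresilting s] {v : T} (hv : (weightLE s).rightOrthogonal v) :
    weightGT s v := fun _ hj f ↦ hv f (shift_mem_weightLE s hj)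

lemma weightGT_shift_one {v : T} (hv : weightGT s v) : weightGT s (v⟦(1 : ℤ)⟧) := fun j hj ↦
  (hv (j - 1) (by lia)).shift_right (by lia)

lemma fgRight_of_shift {s y : T} (h : FGRight (s⟦(1 : ℤ)⟧) (y⟦(1 : ℤ)⟧)) : FGRight s y := by
  obtain ⟨n, g, hg⟩ := h
  choose g' hg' using fun i ↦ (shiftFunctor T (1 : ℤ)).map_surjective (g i)
  refine ⟨n, g', fun f ↦ ?_⟩
  obtain ⟨r, hr⟩ := hg (f⟦1⟧')
  choose r' hr' using fun i ↦ (shiftFunctor T (1 : ℤ)).map_surjective (r i)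
  refine ⟨r', (shiftFunctor T (1 : ℤ)).map_injective ?_⟩
  simp only [hr, Functor.map_sum, Functor.map_comp, hg', hr']

variable [HasZeroObject T] [Pretriangulated T]

instance : (weightLeft s).ContainsZero :=
  ⟨_, isZero_zero T, prop_zero _, fgLeft_of_homZero (homZero_of_isZero_left (isZero_zero T))⟩

instance : (weightRight s).ContainsZero :=
  ⟨_, isZero_zero T, prop_zero _, fgRight_of_homZero (homZero_of_isZero_right (isZero_zero T))⟩

instance [IsPresilting s] : (weightLeft s).IsTriangulatedClosed₂ :=
  .mk' fun S hS h₁ h₃ ↦ ⟨ext_of_isTriangulatedClosed₂ _ S hS h₁.1 h₃.1,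
    fgLeft_obj₂ S hS h₁.2 h₃.2 (weightLE_of_leftOrthogonal s h₃.1 1 one_pos)⟩

instance [IsPresilting s] : (weightRight s).IsTriangulatedClosed₂ :=
  .mk' fun S hS h₁ h₃ ↦ ⟨ext_of_isTriangulatedClosed₂ _ S hS h₁.1 h₃.1,
    fgRight_obj₂ S hS h₁.2 h₃.2 <|
      (weightGT_of_rightOrthogonal s h₁.1 0 le_rfl).shift_right (by lia)⟩

instance [IsPresilting s] [IsTriangulated T] :
    (extensionProduct (weightLeft s) (weightRight s)).IsTriangulatedClosed₂ :=
  isTriangulatedClosed₂_extensionProduct fun _ _ hp hq f ↦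
    hp.1 f (weightGT_shift_one s (weightGT_of_rightOrthogonal s hq.1))

instance : (extensionProduct (weightLeft s) (weightRight s)).ContainsZero :=
  ⟨_, isZero_zero T, le_extensionProduct_left _ _ (prop_zero _)⟩

/-- The objects all of whose shifts have weight decompositions with respect to `s`, and whose
weights are bounded. -/
def weightBounded : ObjectProperty T :=
  evShift ⊤ (extensionProduct (weightLeft s) (weightRight s)) ⊓
    (evShift atBot (weightGT s).leftOrthogonal ⊓ evShift atTop (weightLE s).rightOrthogonal)

instance : (weightBounded s).IsClosedUnderIsomorphisms := by
  unfold weightBounded; infer_instance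

instance [IsPresilting s] [IsTriangulated T] : (weightBounded s).IsTriangulated := by
  unfold weightBounded; infer_instance

lemma weightBounded_self [hs : IsPresilting s] : weightBounded s s := by
  have hl (n : ℤ) (hn : n ≤ 0) : (weightGT s).leftOrthogonal (s⟦n⟧) := fun _ f hY ↦ hY n hn f
  have hr (n : ℤ) (hn : 1 ≤ n) : (weightLE s).rightOrthogonal (s⟦n⟧) := fun _ f hX ↦ hX n hn f
  -- Each shift lies wholly on one side: left for `n ≤ 0`, right for `n ≥ 1`. Only `n = 0` and `n =
  -- 1` need a generator.
  refine ⟨eventually_top.2 fun n ↦ ?_, eventually_atBot.2 ⟨0, hl⟩, eventually_atTop.2 ⟨1, hr⟩⟩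
  obtain hn | hn := le_or_gt n 0
  · refine le_extensionProduct_left _ _ ⟨hl n hn, ?_⟩
    obtain rfl | hn := hn.eq_or_lt
    · exact (FGLeft s).prop_of_iso ((shiftFunctorZero T ℤ).symm.app s) (fgLeft_self s)
    · exact fgLeft_of_homZero ((hs.homZero (-n) (by lia)).shift_left (by lia) |>.of_iso
        (Iso.refl _) ((shiftFunctorZero T ℤ).symm.app s))
  · refine le_extensionProduct_right _ _ ⟨hr n hn, ?_⟩
    obtain rfl | hn := (show 1 ≤ n from hn).eq_or_lt
    · exact fgRight_self _
    · exact fgRight_of_homZero ((hs.homZero (n - 1) (by lia)).shift_left (by lia))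

variable {s}

/-- The map from `x` to its right part vanishes, so `x` is a retract of its left part. This is the
source of the finite generation of Hom(x, s). -/
lemma weightLeft_of_weightLE {x : T} (hx : weightBounded s x) (h : weightLE s x) :
    weightLeft s x := by
  obtain ⟨u, w, f, g, k, hT, hu, hw⟩ := (extensionProduct _ _).prop_of_iso
    ((shiftFunctorZero T ℤ).app x) (eventually_top.1 hx.1 0)
  obtain ⟨r⟩ := retract_obj₂_obj₁ _ hT (hw.1 g h)
  exact prop_of_retract _ r hu

lemma weightRight_of_weightGT {y : T} (hy : weightBounded s y) (h : weightGT s y) :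
    weightRight s y := by
  obtain ⟨u, w, f, g, k, hT, hu, hw⟩ := (extensionProduct _ _).prop_of_iso
    ((shiftFunctorZero T ℤ).app y) (eventually_top.1 hy.1 0)
  obtain ⟨r⟩ := retract_obj₂_obj₃ _ hT (hu.1 f h)
  exact prop_of_retract _ r hw

lemma exists_shift_weightLE [IsPresilting s] [IsTriangulated T] {x : T} (hx : weightBounded s x)
    (h0 : ¬ IsZero x) :
    ∃ q : ℤ, weightLE s (x⟦q⟧) ∧ ¬ HomZero (x⟦q⟧) s := by
  -- Otherwise `weightLE` propagates to all shifts of `x`; a high shift is then orthogonal to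
  -- itself, forcing `x` to be zero.
  by_contra! H
  obtain ⟨a, ha⟩ := eventually_atBot.1 hx.2.1
  have hle : ∀ q, weightLE s (x⟦q⟧) := fun q ↦ by
    obtain hq | hq := le_total q a
    · exact weightLE_of_leftOrthogonal s (ha q hq)
    · induction q, hq using Int.leInduction with
      | base => exact weightLE_of_leftOrthogonal s (ha a le_rfl)
      | succ q _ ih =>
        intro j hj
        obtain rfl | hj := (show 1 ≤ j from hj).eq_or_lt
        · exact HomZero.shift (a := q) (b := 0)
            ((H q ih).of_iso (Iso.refl _) ((shiftFunctorZero T ℤ).app s)) (by lia)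
        · exact HomZero.shift (ih (j - 1) (by lia)) (by lia)
  obtain ⟨b, hb⟩ := eventually_atTop.1 hx.2.2
  have := isZero_of_homZero fun f ↦ hb b le_rfl f (hle b)
  exact h0 (IsZero.of_iso (Functor.map_isZero (shiftFunctor T (-b)) this) (shiftShiftNeg x b).symm)

lemma exists_shift_weightGT [IsPresilting s] [IsTriangulated T] {y : T} (hy : weightBounded s y)
    (h0 : ¬ IsZero y) :
    ∃ q : ℤ, weightGT s (y⟦q⟧) ∧ ¬ HomZero (s⟦(1 : ℤ)⟧) (y⟦q⟧) := by
  by_contra! H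
  obtain ⟨a, ha⟩ := eventually_atTop.1 hy.2.2
  have hle : ∀ q, weightGT s (y⟦q⟧) := fun q ↦ by
    obtain hq | hq := le_total a q
    · exact weightGT_of_rightOrthogonal s (ha q hq)
    · induction q, hq using Int.leInductionDown with
      | base => exact weightGT_of_rightOrthogonal s (ha a le_rfl)
      | pred q _ ih =>
        intro j hj
        obtain rfl | hj := hj.eq_or_lt
        · exact HomZero.shift (H q ih) (by lia)
        · exact HomZero.shift (ih (j + 1) (by lia)) (by lia)
  obtain ⟨b, hb⟩ := eventually_atBot.1 hy.2.1
  have := isZero_of_homZero fun f ↦ hb b le_rfl f (hle b)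
  exact h0 (IsZero.of_iso (Functor.map_isZero (shiftFunctor T (-b)) this) (shiftShiftNeg y b).symm)

/-- Minimal generators give G : x → sⁿ⁺¹ and K : sᵐ⁺¹ → y, with cones z and w such that Hom(z, w) =
0. If Hom(x, y) = 0, a matrix unit φ composed with K factors through δ : sⁿ⁺¹ → z, and the factor z
→ y lifts along K to β. Now Gδβ = 0 and (φ - δβ)K = 0, while the (0,0) entries of δβ and φ - δβ sum
to 1. By locality one of them is invertible, contradicting minimality of G or of K. -/
lemma exists_ne_zero_of_weights [hs : IsPresilting s] [IsTriangulated T]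
    (hloc : ∀ a b : s ⟶ s, a + b = 𝟙 s → IsIso a ∨ IsIso b)
    {x y : T} (hxb : weightBounded s x) (hx : weightLE s x) (hx0 : ¬ HomZero x s)
    (hyb : FGRight s y) (hy : ∀ j : ℤ, j < 0 → HomZero (s⟦j⟧) y) (hy0 : ¬ HomZero s y) :
    ¬ HomZero x y := by
  intro hxy
  obtain ⟨n, g, hg, hgmin⟩ := (weightLeft_of_weightLE hxb hx).2.exists_minimal
  obtain ⟨m, k, hk, hkmin⟩ := hyb.exists_minimal
  obtain _ | n := n
  · exact hx0 fun f ↦ by obtain ⟨r, rfl⟩ := hg f; simp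
  obtain _ | m := m
  · exact hy0 fun f ↦ by obtain ⟨r, rfl⟩ := hk f; simp
  let G : x ⟶ ⨁ fun _ : Fin (n + 1) ↦ s := biproduct.lift g
  let K : (⨁ fun _ : Fin (m + 1) ↦ s) ⟶ y := biproduct.desc k
  obtain ⟨z, δ, ε, hz⟩ := distinguished_cocone_triangle G
  obtain ⟨w, p, η, hw⟩ := distinguished_cocone_triangle K
  have hsb : weightBounded s (⨁ fun _ : Fin (n + 1) ↦ s) :=
    prop_biproduct _ fun _ ↦ weightBounded_self s
  have hzb : weightBounded s z := ext_of_isTriangulatedClosed₃ _ _ hz hxb hsb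
  have hzLE : weightLE s z := by
    intro j hj φ
    obtain ⟨ψ, rfl⟩ : ∃ ψ : x⟦(1 : ℤ)⟧ ⟶ s⟦j⟧, φ = ε ≫ ψ := Triangle.yoneda_exact₃ _ hz φ
      (homZero_biproduct_left (hs.homZero j hj) _)
    obtain rfl | hj := (show 1 ≤ j from hj).eq_or_lt
    · obtain ⟨ψ, rfl⟩ := (shiftFunctor T (1 : ℤ)).map_surjective ψ
      obtain ⟨r, rfl⟩ := hg ψ
      have : ∑ i, g i ≫ r i = G ≫ biproduct.desc r := by simp [G, biproduct.lift_desc]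
      have h0 : ε ≫ G⟦1⟧' = 0 := comp_distTriang_mor_zero₃₁ _ hz
      rw [this, Functor.map_comp, reassoc_of% h0, zero_comp]
    · rw [(HomZero.shift_left (hx (j - 1) (by lia)) (by lia) : HomZero (x⟦(1 : ℤ)⟧) (s⟦j⟧)) ψ,
        comp_zero]
  have hwGT : weightGT s w := by
    intro j hj φ
    have h1 : HomZero (s⟦j⟧) ((⨁ fun _ : Fin (m + 1) ↦ s)⟦(1 : ℤ)⟧) :=
      (homZero_biproduct_right (hs.homZero (1 - j) (by lia) |>.shift_left (c := j - 1) (d := 0)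
        (by lia) |>.of_iso (Iso.refl _) ((shiftFunctorZero T ℤ).symm.app s))).shift_right (by lia)
    obtain ⟨ψ, rfl⟩ : ∃ ψ : s⟦j⟧ ⟶ y, φ = ψ ≫ p := Triangle.coyoneda_exact₃ _ hw φ (h1 _)
    obtain rfl | hj := hj.eq_or_lt
    · obtain ⟨r, hr⟩ := hk ((shiftFunctorZero T ℤ).inv.app s ≫ ψ)
      have : ∑ i, r i ≫ k i = biproduct.lift r ≫ K := by simp [K, biproduct.lift_desc]
      have h0 : K ≫ p = 0 := comp_distTriang_mor_zero₁₂ _ hw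
      rw [← cancel_epi ((shiftFunctorZero T ℤ).inv.app s), comp_zero]
      rw [← Category.assoc, hr, this, Category.assoc, h0, comp_zero]
    · rw [hy j hj ψ, zero_comp]
  let φ : (⨁ fun _ : Fin (n + 1) ↦ s) ⟶ ⨁ fun _ : Fin (m + 1) ↦ s :=
    biproduct.π _ 0 ≫ biproduct.ι (fun _ : Fin (m + 1) ↦ s) 0
  obtain ⟨α, hα⟩ : ∃ α : z ⟶ y, φ ≫ K = δ ≫ α := Triangle.yoneda_exact₂ _ hz (φ ≫ K) (hxy _)
  obtain ⟨β, rfl⟩ : ∃ β : z ⟶ ⨁ fun _ : Fin (m + 1) ↦ s, α = β ≫ K :=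
    Triangle.coyoneda_exact₂ _ hw α ((weightLeft_of_weightLE hzb hzLE).1 _ hwGT)
  have hGδ : G ≫ δ = 0 := comp_distTriang_mor_zero₁₂ _ hz
  have hsum : biproduct.ι (fun _ ↦ s) 0 ≫ δ ≫ β ≫ biproduct.π (fun _ ↦ s) 0 +
      biproduct.ι (fun _ ↦ s) 0 ≫ (φ - δ ≫ β) ≫ biproduct.π (fun _ ↦ s) 0 = 𝟙 s := by
    simp [φ]
  obtain h | h := hloc _ _ hsum
  · refine hgmin (fun i ↦ biproduct.ι (fun _ ↦ s) i ≫ δ ≫ β ≫ biproduct.π (fun _ ↦ s) 0) ?_ 0 h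
    have : ∑ i, g i ≫ biproduct.ι (fun _ : Fin (n + 1) ↦ s) i = G := by
      simp [G, biproduct.lift_eq]
    simp only [← Category.assoc, ← Preadditive.sum_comp, this, hGδ, zero_comp]
  · refine hkmin (fun i ↦ biproduct.ι (fun _ ↦ s) 0 ≫ (φ - δ ≫ β) ≫ biproduct.π (fun _ ↦ s) i)
      ?_ 0 h
    have : ∑ i, biproduct.π (fun _ : Fin (m + 1) ↦ s) i ≫ k i = K := by
      simp [K, biproduct.desc_eq]
    simp only [Category.assoc, ← Preadditive.comp_sum, this]
    simp [Preadditive.sub_comp, hα]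

/-- Between two nonzero objects of bounded weight with respect to a presilting object with local
endomorphism ring, there is a nonzero morphism of some degree. -/
lemma exists_shift_not_homZero [IsPresilting s] [IsTriangulated T]
    (hloc : ∀ a b : s ⟶ s, a + b = 𝟙 s → IsIso a ∨ IsIso b)
    {x y : T} (hx : weightBounded s x) (hx0 : ¬ IsZero x) (hy : weightBounded s y)
    (hy0 : ¬ IsZero y) : ∃ n : ℤ, ¬ HomZero x (y⟦n⟧) := by
  obtain ⟨p, hp, hp0⟩ := exists_shift_weightLE hx hx0
  obtain ⟨q, hq, hq0⟩ := exists_shift_weightGT hy hy0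
  -- The right-hand conditions are generated by `s⟦1⟧`, hence the passage from `q` to `q - 1`.
  let e : (y⟦q - 1⟧)⟦(1 : ℤ)⟧ ≅ y⟦q⟧ := (shiftFunctorAdd' T (q - 1) 1 q (by lia)).symm.app y
  have := exists_ne_zero_of_weights hloc ((weightBounded s).le_shift p _ hx) hp hp0
    (y := y⟦q - 1⟧)
    (fgRight_of_shift ((FGRight (s⟦(1 : ℤ)⟧)).prop_of_iso e.symm
      (weightRight_of_weightGT ((weightBounded s).le_shift q _ hy) hq).2))
    (fun j hj ↦ HomZero.shift (hq (j + 1) (by lia)) (by lia))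
    (fun h ↦ hq0 (((homZero_shift_iff _ _ 1).2 h).of_iso (Iso.refl _) e.symm))
  exact ⟨q - 1 - p, fun h ↦ this (h.shift_left (by lia))⟩

end Weight

end Silting

namespace Silting

open ObjectProperty

/-! ### Generation up to retracts, and local endomorphism rings. -/

section

variable {T : Type u} [Category.{v} T] [Preadditive T] [HasZeroObject T] [HasShift T ℤ]
  [∀ n : ℤ, (shiftFunctor T n).Additive] [Pretriangulated T]

lemma le_add (P : ObjectProperty T) : P ≤ add P := fun X hX ↦
  ⟨1, fun _ ↦ X, fun _ ↦ hX,
    ⟨⟨biproduct.ι (fun _ : Fin 1 ↦ X) 0, biproduct.π (fun _ : Fin 1 ↦ X) 0, by simp⟩⟩⟩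

lemma biprod_shift_mem_of_isClassicalTriangulatedGenerator [IsTriangulated T]
    {S : ObjectProperty T} (hS : (add S).IsClassicalTriangulatedGenerator)
    (D : ObjectProperty T) [D.IsTriangulated] [D.IsClosedUnderIsomorphisms] (h : S ≤ D) (t : T) :
    D (t ⊞ t⟦(1 : ℤ)⟧) := by
  have := isTriangulatedClosed₂_retractClosure D
  have := isStableUnderShift_retractClosure D
  have : D.retractClosure.IsTriangulated := {}
  have hle : (add S).triangEnvelope ≤ D.retractClosure := by
    rw [triangEnvelope_le_iff]
    rintro X ⟨n, f, hf, ⟨r⟩⟩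
    exact prop_retractClosure (prop_biproduct D fun i ↦ h _ (hf i)) r
  rw [hS] at hle
  obtain ⟨w, hw, ⟨r⟩⟩ := hle t trivial
  exact biprod_shift_mem_of_retract D hw r

/-- In a Krull–Schmidt category, an indecomposable object has a local endomorphism ring. -/
lemma isIso_or_isIso_of_indecomposable [IsKrullSchmidt T] {s : T} (hs : Indecomposable s)
    (a b : s ⟶ s) (hab : a + b = 𝟙 s) : IsIso a ∨ IsIso b := by
  obtain ⟨n, f, hf, ⟨e⟩⟩ := IsKrullSchmidt.exists_decomposition s
  obtain _ | n := n
  · refine (hs.1 (IsZero.of_iso ?_ e)).elim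
    rw [IsZero.iff_id_eq_zero]
    ext i
    exact i.elim0
  let i : f 0 ⟶ s := biproduct.ι f 0 ≫ e.inv
  have hir : i ≫ e.hom ≫ biproduct.π f 0 = 𝟙 _ := by simp [i]
  have := (SplitMono.mk _ hir).mono
  -- The cone of the split monomorphism `i` is a complement of `f 0`, and it vanishes by
  -- indecomposability.
  obtain ⟨z, p, h, hT⟩ := distinguished_cocone_triangle i
  obtain ⟨e', -⟩ := exists_iso_binaryBiproduct_of_distTriang _ hT
    ((Triangle.mor₃_eq_zero_iff_mono₁ _ hT).2 this)
  have := hf 0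
  have h0 : ¬ IsZero (f 0) := fun h ↦ one_ne_zero (α := End (f 0)) (h.eq_of_src _ _)
  have hi : IsIso i := (Triangle.isZero₃_iff_isIso₁ _ hT).1 ((hs.2 _ _ e').resolve_left h0)
  have hsum : (End.of (i ≫ a ≫ inv i) : End (f 0)) + End.of (i ≫ b ≫ inv i) = 1 := by
    change i ≫ a ≫ inv i + i ≫ b ≫ inv i = 𝟙 _
    rw [← Preadditive.comp_add, ← Preadditive.add_comp, hab]
    simp
  have aux (c : s ⟶ s) (hc : IsUnit (End.of (i ≫ c ≫ inv i))) : IsIso c := by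
    have : IsIso (i ≫ c ≫ inv i) := (isUnit_iff_isIso _).1 hc
    have : IsIso (c ≫ inv i) := IsIso.of_isIso_comp_left i _
    exact IsIso.of_isIso_comp_right c (inv i)
  exact (IsLocalRing.isUnit_or_isUnit_of_add_one hsum).imp (aux a) (aux b)

end

/-! ### The dichotomy for a co-t-structure. -/

namespace CoTStructure

variable {T : Type u} [Category.{v} T] [Preadditive T] [HasZeroObject T] [HasShift T ℤ]
  [∀ n : ℤ, (shiftFunctor T n).Additive] [Pretriangulated T] (τ : CoTStructure T)

/-- If every `t ⊞ t⟦1⟧` is an extension, in some order, of a bounded object and an object of a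
triangulated subcategory `Y`, then a thick subcategory containing the bounded objects and meeting
`Y` trivially consists of bounded objects. -/
lemma le_bounded_of_disjoint {Y P : ObjectProperty T}
    (hD : ∀ t, extensionProduct τ.bounded Y (t ⊞ t⟦(1 : ℤ)⟧) ∨
      extensionProduct Y τ.bounded (t ⊞ t⟦(1 : ℤ)⟧))
    [P.IsTriangulated] [P.IsStableUnderRetracts] (hP : τ.bounded ≤ P)
    (h : ∀ y, P y → Y y → IsZero y) : P ≤ τ.bounded := by
  intro t ht
  have ht' : P (t ⊞ t⟦(1 : ℤ)⟧) := P.ext_of_isTriangulatedClosed₂ _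
    (binaryBiproductTriangle_distinguished t (t⟦(1 : ℤ)⟧)) ht (P.le_shift 1 _ ht)
  suffices hb : τ.bounded (t ⊞ t⟦(1 : ℤ)⟧) from
    ⟨IsStableUnderRetracts.of_biprod_left _ hb.1, IsStableUnderRetracts.of_biprod_left _ hb.2⟩
  obtain ⟨x, y, f, g, k, hT, hx, hy⟩ | ⟨y, x, f, g, k, hT, hy, hx⟩ := hD t
  · have hy0 : IsZero y := h y (P.ext_of_isTriangulatedClosed₃ _ hT (hP _ hx) ht') hy
    have : IsIso f := (Triangle.isZero₃_iff_isIso₁ _ hT).1 hy0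
    exact τ.bounded.prop_of_iso (asIso f) hx
  · have hy0 : IsZero y := h y (P.ext_of_isTriangulatedClosed₁ _ hT ht' (hP _ hx)) hy
    have : IsIso g := (Triangle.isZero₁_iff_isIso₂ _ hT).1 hy0
    exact τ.bounded.prop_of_iso (asIso g).symm hx

lemma disjoint_or_disjoint [IsTriangulated T] {s : T} [IsPresilting s]
    (hloc : ∀ a b : s ⟶ s, a + b = 𝟙 s → IsIso a ∨ IsIso b)
    {Y : ObjectProperty T} [Y.IsStableUnderShift ℤ] (hY : Y ≤ weightBounded s)
    (hYb : Y ≤ τ.bounded.rightOrthogonal ∨ Y ≤ τ.bounded.leftOrthogonal) :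
    (∀ y, τ.minus y → Y y → IsZero y) ∨ (∀ y, τ.plus y → Y y → IsZero y) := by
  by_contra! H
  obtain ⟨⟨x, hx, hxY, hx0⟩, y, hy, hyY, hy0⟩ := H
  obtain ⟨n, hn⟩ := exists_shift_not_homZero hloc (hY _ hxY) hx0 (hY _ hyY) hy0
  refine hn fun f ↦ ?_
  obtain ⟨c, hc, p, q, rfl⟩ := τ.exists_factorization hx (τ.plus.le_shift n _ hy) f
  obtain h | h := hYb
  · rw [h _ (Y.le_shift n _ hyY) q hc, comp_zero]
  · rw [h _ hxY p hc, zero_comp]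

lemma boundedAbove_or_boundedBelow_of_extensionProduct [IsTriangulated T] {s : T} [IsPresilting s]
    (hloc : ∀ a b : s ⟶ s, a + b = 𝟙 s → IsIso a ∨ IsIso b) (hs : ¬ IsZero s)
    {Y : ObjectProperty T} [Y.IsStableUnderShift ℤ] (hY : Y ≤ weightBounded s)
    (hYb : Y ≤ τ.bounded.rightOrthogonal ∨ Y ≤ τ.bounded.leftOrthogonal) (hsY : Y s)
    (hD : ∀ t, extensionProduct τ.bounded Y (t ⊞ t⟦(1 : ℤ)⟧) ∨
      extensionProduct Y τ.bounded (t ⊞ t⟦(1 : ℤ)⟧)) :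
    (τ.BoundedAbove ∨ τ.BoundedBelow) ∧ (τ.plus s → τ.minus ≤ τ.bounded) ∧
      (τ.minus s → τ.plus ≤ τ.bounded) := by
  have hm := τ.le_bounded_of_disjoint hD (P := τ.minus) inf_le_left
  have hp := τ.le_bounded_of_disjoint hD (P := τ.plus) inf_le_right
  obtain h | h := τ.disjoint_or_disjoint hloc hY hYb
  · exact ⟨.inl (τ.boundedAbove_of_le ((hm h).trans inf_le_right)), fun _ ↦ hm h,
      fun h' ↦ (hs (h s h' hsY)).elim⟩
  · exact ⟨.inr (τ.boundedBelow_of_le ((hp h).trans inf_le_left)),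
      fun h' ↦ (hs (h s h' hsY)).elim, fun _ ↦ hp h⟩

end CoTStructure

/-! ### Application to a complement of the co-heart. -/

section Complement

variable {T : Type u} [Category.{v} T] [Preadditive T] [HasZeroObject T] [HasShift T ℤ]
  [∀ n : ℤ, (shiftFunctor T n).Additive] [Pretriangulated T] (τ : CoTStructure T)
  {S : ObjectProperty T} {s : T}

lemma IsComplement.isPresilting (hs : IsComplement S s) : IsPresilting s where
  homZero j hj := hs.2.1 (le_add _ _ (.inr (by simp))) (le_add _ _ (.inr (by simp))) j hj

lemma IsComplement.homZero_left (hs : IsComplement S s) {c : T} (hc : S c) {j : ℤ} (hj : 0 < j) :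
    HomZero c (s⟦j⟧) :=
  hs.2.1 (le_add _ _ (.inl hc)) (le_add _ _ (.inr (by simp))) j hj

lemma IsComplement.homZero_right (hs : IsComplement S s) {c : T} (hc : S c) {j : ℤ} (hj : 0 < j) :
    HomZero s (c⟦j⟧) :=
  hs.2.1 (le_add _ _ (.inr (by simp))) (le_add _ _ (.inl hc)) j hj

variable [IsTriangulated T] [IsKrullSchmidt T]

theorem boundedness_of_rightOrthogonal (hs : IsComplement τ.coheart s)
    (h : ∀ c : T, τ.coheart c → ∀ n : ℤ, n ≤ 0 → HomZero c (s⟦n⟧)) :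
    (τ.BoundedAbove ∨ τ.BoundedBelow) ∧ ((∃ k : ℤ, τ.B (s⟦k⟧)) ↔ ∀ k : ℤ, τ.B (s⟦k⟧)) ∧
      ((∃ k : ℤ, τ.B (s⟦k⟧)) → τ.BoundedAbove) := by
  have := hs.isPresilting
  have hall (c : T) (hc : τ.coheart c) (n : ℤ) : HomZero c (s⟦n⟧) := by
    obtain hn | hn := le_or_gt n 0
    · exact h c hc n hn
    · exact hs.homZero_left hc hn
  have horth : τ.bounded.rightOrthogonal s := by
    -- Orthogonality is tested against all shifts of `s` at once so that `Q` is triangulated.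
    have := τ.bounded_le (Q := ((ObjectProperty.singleton s).shiftClosure ℤ).leftOrthogonal) (by
      rintro c hc y f ⟨z, n, e, hz⟩
      obtain rfl : s = z := by simpa using hz
      exact (hall c hc n).of_iso (Iso.refl _) e f)
    exact fun c f hc ↦ this c hc f (le_shiftClosure _ _ (by simp))
  let Y := weightBounded s ⊓ τ.bounded.rightOrthogonal
  have hsY : Y s := ⟨weightBounded_self s, horth⟩
  let D := extensionProduct τ.bounded Y
  have : D.IsTriangulatedClosed₂ := isTriangulatedClosed₂_extensionProduct fun p q hp hq f ↦
    τ.bounded.rightOrthogonal.le_shift 1 _ hq.2 f hp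
  have : D.IsTriangulated :=
    { exists_zero := ⟨_, isZero_zero T, le_extensionProduct_left _ _ (prop_zero _)⟩ }
  have hD (t : T) : D (t ⊞ t⟦(1 : ℤ)⟧) := by
    refine biprod_shift_mem_of_isClassicalTriangulatedGenerator hs.2.2 D (sup_le ?_ ?_) t
    · exact τ.coheart_le_bounded.trans (le_extensionProduct_left _)
    · rintro z hz
      obtain rfl : s = z := by simpa using hz
      exact le_extensionProduct_right _ _ hsY
  obtain ⟨h₁, h₂, -⟩ := τ.boundedAbove_or_boundedBelow_of_extensionProduct
    (isIso_or_isIso_of_indecomposable hs.1) hs.1.1 (Y := Y) inf_le_left (.inl inf_le_right) hsY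
    fun t ↦ .inl (hD t)
  refine ⟨h₁, ⟨fun hk k ↦ ?_, fun hk ↦ ⟨0, hk 0⟩⟩, fun hk ↦ ?_⟩
  · exact τ.mem_B_of_homZero fun a ha f ↦ τ.bounded.rightOrthogonal.le_shift k _ horth f
      (h₂ (τ.plus_iff.2 hk) _ (τ.minus_of_A ha))
  · exact τ.boundedAbove_of_le ((h₂ (τ.plus_iff.2 hk)).trans inf_le_right)

theorem boundedness_of_leftOrthogonal (hs : IsComplement τ.coheart s)
    (h : ∀ c : T, τ.coheart c → ∀ n : ℤ, n ≤ 0 → HomZero s (c⟦n⟧)) :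
    (τ.BoundedAbove ∨ τ.BoundedBelow) ∧ ((∃ k : ℤ, τ.A (s⟦k⟧)) ↔ ∀ k : ℤ, τ.A (s⟦k⟧)) ∧
      ((∃ k : ℤ, τ.A (s⟦k⟧)) → τ.BoundedBelow) := by
  have := hs.isPresilting
  have hall (c : T) (hc : τ.coheart c) (n : ℤ) : HomZero (s⟦n⟧) c := by
    obtain hn | hn := le_or_gt (-n) 0
    · exact ((h c hc (-n) hn).shift_left (neg_add_cancel n)).of_iso (Iso.refl _)
        ((shiftFunctorZero T ℤ).symm.app c)
    · exact ((hs.homZero_right hc hn).shift_left (neg_add_cancel n)).of_iso (Iso.refl _)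
        ((shiftFunctorZero T ℤ).symm.app c)
  have horth : τ.bounded.leftOrthogonal s := by
    have := τ.bounded_le (Q := ((ObjectProperty.singleton s).shiftClosure ℤ).rightOrthogonal) (by
      rintro c hc y f ⟨z, n, e, hz⟩
      obtain rfl : s = z := by simpa using hz
      exact (hall c hc n).of_iso e (Iso.refl _) f)
    exact fun c f hc ↦ this c hc f (le_shiftClosure _ _ (by simp))
  let Y := weightBounded s ⊓ τ.bounded.leftOrthogonal
  have hsY : Y s := ⟨weightBounded_self s, horth⟩
  let D := extensionProduct Y τ.bounded
  have : D.IsTriangulatedClosed₂ := isTriangulatedClosed₂_extensionProduct fun p q hp hq f ↦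
    hp.2 f (τ.bounded.le_shift 1 _ hq)
  have : D.IsTriangulated :=
    { exists_zero := ⟨_, isZero_zero T, le_extensionProduct_left _ _ (prop_zero _)⟩ }
  have hD (t : T) : D (t ⊞ t⟦(1 : ℤ)⟧) := by
    refine biprod_shift_mem_of_isClassicalTriangulatedGenerator hs.2.2 D (sup_le ?_ ?_) t
    · exact τ.coheart_le_bounded.trans (le_extensionProduct_right _)
    · rintro z hz
      obtain rfl : s = z := by simpa using hz
      exact le_extensionProduct_left _ _ hsY
  obtain ⟨h₁, -, h₂⟩ := τ.boundedAbove_or_boundedBelow_of_extensionProduct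
    (isIso_or_isIso_of_indecomposable hs.1) hs.1.1 (Y := Y) inf_le_left (.inr inf_le_right) hsY
    fun t ↦ .inr (hD t)
  refine ⟨h₁, ⟨fun hk k ↦ ?_, fun hk ↦ ⟨0, hk 0⟩⟩, fun hk ↦ ?_⟩
  · exact τ.mem_A_of_homZero fun b hb f ↦ τ.bounded.leftOrthogonal.le_shift k _ horth f
      (h₂ (τ.minus_iff.2 hk) _ (τ.plus_of_B hb))
  · exact τ.boundedBelow_of_le ((h₂ (τ.minus_iff.2 hk)).trans inf_le_left)

end Complement

end Silting

theorem mainTheorem7 {T : Type u} [Category.{v} T] [Preadditive T] [HasZeroObject T]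
    [HasShift T ℤ] [∀ n : ℤ, (shiftFunctor T n).Additive] [Pretriangulated T]
    [IsTriangulated T] [Silting.IsKrullSchmidt T]
    (τ : Silting.CoTStructure T) (hC : Silting.IsAlmostSilting τ.coheart)
    (s : T) (hs : Silting.IsComplement τ.coheart s) :
    ((∀ c : T, τ.coheart c → ∀ n : ℤ, n ≤ 0 → ∀ f : c ⟶ s⟦n⟧, f = 0) →
      (τ.BoundedAbove ∨ τ.BoundedBelow) ∧
      ((∃ k : ℤ, τ.B (s⟦k⟧)) ↔ ∀ k : ℤ, τ.B (s⟦k⟧)) ∧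
      ((∃ k : ℤ, τ.B (s⟦k⟧)) → τ.BoundedAbove)) ∧
    ((∀ c : T, τ.coheart c → ∀ n : ℤ, n ≤ 0 → ∀ f : s ⟶ c⟦n⟧, f = 0) →
      (τ.BoundedAbove ∨ τ.BoundedBelow) ∧
      ((∃ k : ℤ, τ.A (s⟦k⟧)) ↔ ∀ k : ℤ, τ.A (s⟦k⟧)) ∧
      ((∃ k : ℤ, τ.A (s⟦k⟧)) → τ.BoundedBelow)) := by
  exact ⟨Silting.boundedness_of_rightOrthogonal τ hs, Silting.boundedness_of_leftOrthogonal τ hs⟩
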